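/- Let $G$ be a directed acyclic graph on a finite linearly ordered vertex set $V$. A trek from $i$ to $j$ is a simple path from $i$ to $j$ in the underlying undirected graph that contains no two distinct edges $k\to l$, $k'\to l$ with the same head; $T(i,j)$ is the set of treks from $i$ to $j$, and $\mathrm{top}(P)$ is the unique vertex of the trek $P$ that is not the head of an edge of $P$ (for $i=j$ the only trek is the empty one, with top $i$). Let $$\phi_G:\mathbb{C}[\sigma_{ij} \mid i\le j]\to\mathbb{C}[a_v,\lambda_{kl} \mid v\in V,\ k\to l\in E(G)],\qquad \sigma_{ij}\mapsto\sum_{P\in T(i,j)}a_{\mathrm{top}(P)}\prod_{k\to l\in P}\lambda_{kl},$$ and let $I_G=\ker\phi_G$, a homogeneous ideal. Its degree $\deg I_G$ is $Q(1)$, where the Hilbert series of $\mathbb{C}[\sigma_{ij}]/I_G$ is written as $Q(t)/(1-t)^D$ with $Q\in\mathbb{Z}[t]$ and $Q(1)\neq 0$. A downward directed tree is a directed acyclic graph whose underlying undirected graph is a tree, that has a unique sink, and all of whose edges point to that sink. A leaf of it is a source that is incident to exactly one edge. Let $T$ be a downward directed tree with sink $s$. Then $\deg I_T$ is well defined (a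 $Q$ as above exists), and it is determined recursively as follows. (a) If $T$ consists of a single vertex, then $\deg I_T=1$. (b) For every leaf $i$ of $T$ there is exactly one trek $P$ in $T(i,s)$, and $$\deg I_T=\sum_{k\to l\in P}\deg I_{T\setminus k\to l},$$ where $T\setminus k\to l$ is the forest obtained from $T$ by removing the edge $k\to l$ and keeping all vertices. Moreover, for every edge $k\to l$ of $P$, the connected components $T_k$ and $T_l$ of $T\setminus k\to l$ that contain $k$ and $l$ are downward directed trees with sinks $k$ and $s$, respectively, and $$\deg I_{T\setminus k\to l}=\deg I_{T_k}\cdot\deg I_{T_l}.$$ -/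

import Mathlib

noncomputable section

/-! ### Degree of a homogeneous ideal -/

namespace HilbertDegree

variable {K τ : Type*} [Field K]

/-- The Hilbert function of `K[τ]/I` for a homogeneous ideal `I`: the dimension over `K` of the
degree `d` part of the quotient, i.e. of the image of the forms of degree `d`. -/
def hilbertFunction (I : Ideal (MvPolynomial τ K)) (d : ℕ) : ℕ :=
  Module.finrank K
    ((MvPolynomial.homogeneousSubmodule τ K d).map (Ideal.Quotient.mkₐ K I).toLinearMap)

/-- The Hilbert series of `K[τ]/I`. -/
def hilbertSeries (I : Ideal (MvPolynomial τ K)) : PowerSeries ℤ :=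
  PowerSeries.mk fun d => (hilbertFunction I d : ℤ)

/-- `e` is the degree of the homogeneous ideal `I`: the Hilbert series of `K[τ]/I` can be written
`Q(t) / (1 - t) ^ D` with an integer polynomial `Q` such that `Q(1) = e ≠ 0`. -/
def HasDegree (I : Ideal (MvPolynomial τ K)) (e : ℤ) : Prop :=
  ∃ (D : ℕ) (Q : Polynomial ℤ),
    hilbertSeries I * (1 - PowerSeries.X) ^ D = (Q : PowerSeries ℤ) ∧ Q.eval 1 = e ∧ e ≠ 0

theorem HasDegree.unique {I : Ideal (MvPolynomial τ K)} {e e' : ℤ}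
    (h : HasDegree I e) (h' : HasDegree I e') : e = e' := by
  obtain ⟨D, Q, hQ, he, hne⟩ := h
  obtain ⟨D', Q', hQ', he', hne'⟩ := h'
  have key : Q * (1 - Polynomial.X) ^ D' = Q' * (1 - Polynomial.X) ^ D := by
    apply Polynomial.coe_injective ℤ
    push_cast
    rw [← hQ, ← hQ']
    ring
  rcases lt_trichotomy D D' with hlt | rfl | hlt
  · obtain ⟨c, rfl⟩ := Nat.exists_eq_add_of_lt hlt
    have h0 : (1 - Polynomial.X : Polynomial ℤ) ^ D ≠ 0 :=
      pow_ne_zero _ fun h => by simpa using congrArg (Polynomial.eval 0) h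
    have h1 : Q * (1 - Polynomial.X) ^ (c + 1) = Q' := by
      apply mul_right_cancel₀ h0
      rw [← key]
      ring
    have h2 := congrArg (Polynomial.eval 1) h1
    simp at h2
    omega
  · have h0 : (1 - Polynomial.X : Polynomial ℤ) ^ D ≠ 0 :=
      pow_ne_zero _ fun h => by simpa using congrArg (Polynomial.eval 0) h
    have := mul_right_cancel₀ h0 key
    rw [← he, ← he', this]
  · obtain ⟨c, rfl⟩ := Nat.exists_eq_add_of_lt hlt
    have h0 : (1 - Polynomial.X : Polynomial ℤ) ^ D' ≠ 0 :=
      pow_ne_zero _ fun h => by simpa using congrArg (Polynomial.eval 0) h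
    have h1 : Q' * (1 - Polynomial.X) ^ (c + 1) = Q := by
      apply mul_right_cancel₀ h0
      rw [key]
      ring
    have h2 := congrArg (Polynomial.eval 1) h1
    simp at h2
    omega

open Classical in
/-- The degree of a homogeneous ideal (`0` if the Hilbert series is not of the required form, as
for the unit ideal). -/
def degree (I : Ideal (MvPolynomial τ K)) : ℤ :=
  if h : ∃ e, HasDegree I e then h.choose else 0

end HilbertDegree

/-! ### Directed graphs, treks, and the ideal of a Gaussian Bayesian network -/

namespace BayesNet

variable {V : Type*}

/-- The underlying undirected graph. -/
abbrev skeleton (G : Digraph V) : SimpleGraph V := G.toSimpleGraphInclusive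

/-- Directed acyclic graphs. -/
def IsDAG (G : Digraph V) : Prop := ∀ v, ¬ Relation.TransGen G.Adj v v

/-- A tree is a directed acyclic graph whose underlying undirected graph is a tree. -/
def IsDirTree (G : Digraph V) : Prop := IsDAG G ∧ (skeleton G).IsTree

/-- A sink: a vertex with no outgoing edges. -/
def IsSink (G : Digraph V) (v : V) : Prop := ∀ w, ¬ G.Adj v w

/-- A source: a vertex with no incoming edges. -/
def IsSource (G : Digraph V) (v : V) : Prop := ∀ u, ¬ G.Adj u v

/-- `G` is a downward directed tree with sink `s`: a tree with `s` as its unique sink, all of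
whose edges point to `s`. -/
structure IsDownwardTree (G : Digraph V) (s : V) : Prop where
  isDirTree : IsDirTree G
  isSink_iff : ∀ v, IsSink G v ↔ v = s
  toSink : ∀ k l, G.Adj k l → Relation.ReflTransGen G.Adj l s

/-- A leaf of a downward directed tree: a source that is incident to exactly one edge. -/
def IsLeaf (G : Digraph V) (i : V) : Prop := IsSource G i ∧ ∃! k, (skeleton G).Adj i k

/-- The directed edges `k → l` of `G`, as pairs `(k, l)`. -/
abbrev Edge (G : Digraph V) : Type _ := {e : V × V // G.Adj e.1 e.2}

/-- `G ∖ k → l`: the edge `e = (k, l)` is removed, all vertices are kept. -/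
def deleteEdge (G : Digraph V) (e : V × V) : Digraph V where
  Adj u v := G.Adj u v ∧ (u, v) ≠ e

/-- The connected component of the vertex `v`, as a directed graph on its own vertex set. -/
def component (G : Digraph V) (v : V) : Digraph {w : V // (skeleton G).Reachable v w} where
  Adj u w := G.Adj u.1 w.1

/-- The directed edge `k → l` of `G` is used (in either direction) by the walk `p`. -/
def Uses (G : Digraph V) {i j : V} (p : (skeleton G).Walk i j) (k l : V) : Prop :=
  G.Adj k l ∧ s(k, l) ∈ p.edges

/-- `T(i, j)`: the simple paths from `i` to `j` in the underlying graph without a collider, i.e.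
without two different edges `k → l`, `k' → l` with the same head. -/
def Trek (G : Digraph V) (i j : V) : Type _ :=
  {p : (skeleton G).Path i j // ∀ k k' l, Uses G p.1 k l → Uses G p.1 k' l → k = k'}

/-- The edges of a trek. -/
def Trek.edges [Finite V] {G : Digraph V} {i j : V} (P : Trek G i j) : Finset (Edge G) :=
  (Set.toFinite {e : Edge G | Uses G P.1.1 e.1.1 e.1.2}).toFinset

/-- The topmost vertex of a trek: its unique vertex that is not the head of an edge of the
trek. -/
def Trek.top {G : Digraph V} {i j : V} (P : Trek G i j) : V :=
  @Classical.epsilon V ⟨i⟩ fun v => v ∈ P.1.1.support ∧ ∀ u, ¬ Uses G P.1.1 u v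

/-- The index set of the indeterminates `σ_{ij}`, `i ≤ j`. -/
abbrev SigmaIndex (V : Type*) [LinearOrder V] : Type _ := {p : V × V // p.1 ≤ p.2}

/-- The ring homomorphism `φ_G`, sending `σ_{ij}` to the sum over the treks `P` in `T(i, j)` of
`a_{top(P)} ∏_{k → l ∈ P} λ_{kl}`. The indeterminates of the target are `a_v` (index `Sum.inl v`)
and `λ_e` (index `Sum.inr e`). -/
def trekHom [Finite V] [LinearOrder V] (G : Digraph V) :
    MvPolynomial (SigmaIndex V) ℂ →ₐ[ℂ] MvPolynomial (V ⊕ Edge G) ℂ :=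
  MvPolynomial.aeval fun p =>
    ∑ᶠ P : Trek G p.1.1 p.1.2,
      MvPolynomial.X (Sum.inl P.top) * ∏ e ∈ P.edges, MvPolynomial.X (Sum.inr e)

/-- There are only finitely many treks, so the sum in `trekHom` is a genuine finite sum. -/
instance [Finite V] (G : Digraph V) (i j : V) : Finite (Trek G i j) := by
  classical
  have := Fintype.ofFinite V
  exact Subtype.finite

/-- The ideal `I_G = ker φ_G`. -/
def bayesIdeal [Finite V] [LinearOrder V] (G : Digraph V) :
    Ideal (MvPolynomial (SigmaIndex V) ℂ) :=
  RingHom.ker (trekHom G)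

end BayesNet

end

/-!
In a downward forest every `T(i, j)` has at most one trek, and it has one exactly when the directed
walk of one of `i`, `j` passes through the other. Hence `φ_G` sends the `σ_{ij}` to monomials or
to `0`, and the exponent vectors of these monomials are the unit flows along directed walks. They
generate the monoid of all flows on `G`, in which flow enters anywhere, moves along the edges, and
may disappear on its way. The Hilbert series of the quotient by `I_G` is therefore the generating
series `F_G` of the flows, counted by the amount entering.

Let `i` be a source and `t` the sink below it. On the walk from `i` to `t` there is a first vertex
`k` that no flow leaves. If `k ≠ i`, a unit flow from `i` to `k` can be subtracted, and what remains
is an arbitrary flow with nothing leaving `k`; if `k ≠ t`, this is a flow on `G ∖ k → l`, where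
`k → l` is the edge leaving `k`, and if `k = t` it is any flow on `G`. Writing `X ^ [k ≠ i]` for `1`
or `X`,
  `F_G (1 - X) = ∑ X ^ [k ≠ i] F_{G ∖ k → l}`, summed over the edges `k → l` of the walk.
All summands have poles of the same order at `1` with positive leading coefficients, so comparing
leading coefficients gives the recursion. The product formula holds because a flow on a disjoint
union is a pair of flows.
-/

noncomputable section

/-! ### Generating series and poles at `1` -/

namespace HilbertDegree

section GradedSeries

variable {α β ι : Type*}

/-- The generating series of a set `S` graded by `deg`, whose coefficients count the elements of
each degree. A degree with infinitely many elements contributes the junk value `0`. -/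
def gradedSeries (deg : α → ℕ) (S : Set α) : PowerSeries ℤ :=
  PowerSeries.mk fun d => ({a ∈ S | deg a = d}.ncard : ℤ)

theorem gradedSeries_image {φ : α → β} {S : Set α} (hφ : S.InjOn φ) (deg : β → ℕ) :
    gradedSeries deg (φ '' S) = gradedSeries (deg ∘ φ) S := by
  ext d
  have hfiber : {b ∈ φ '' S | deg b = d} = φ '' {a ∈ S | deg (φ a) = d} := by
    ext b
    constructor
    · rintro ⟨⟨a, ha, rfl⟩, hd⟩
      exact ⟨a, ⟨ha, hd⟩, rfl⟩
    · rintro ⟨a, ⟨ha, hd⟩, rfl⟩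
      exact ⟨⟨a, ha, rfl⟩, hd⟩
  simp only [gradedSeries, PowerSeries.coeff_mk, hfiber, Function.comp_apply]
  rw [(hφ.mono fun _ ha => ha.1).ncard_image]

theorem gradedSeries_add_const (deg : α → ℕ) (n : ℕ) (S : Set α) :
    gradedSeries (fun a => deg a + n) S = PowerSeries.X ^ n * gradedSeries deg S := by
  ext d
  rw [PowerSeries.coeff_X_pow_mul']
  simp only [gradedSeries, PowerSeries.coeff_mk]
  split_ifs with hnd
  · have hshift : ∀ a, deg a + n = d ↔ deg a = d - n := by omega
    simp only [hshift]
  · have hempty : {a ∈ S | deg a + n = d} = ∅ :=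
      Set.eq_empty_of_forall_notMem fun a ha => hnd (ha.2 ▸ Nat.le_add_left _ _)
    simp [hempty]

theorem gradedSeries_prod {deg : α → ℕ} {deg' : β → ℕ} {S : Set α} {T : Set β}
    (hS : ∀ d, {a ∈ S | deg a = d}.Finite) (hT : ∀ d, {b ∈ T | deg' b = d}.Finite) :
    gradedSeries (fun x : α × β => deg x.1 + deg' x.2) (S ×ˢ T) =
      gradedSeries deg S * gradedSeries deg' T := by
  ext d
  have hfiber : {x ∈ S ×ˢ T | deg x.1 + deg' x.2 = d} =
      ⋃ n ∈ (Finset.HasAntidiagonal.antidiagonal d : Set (ℕ × ℕ)),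
        {a ∈ S | deg a = n.1} ×ˢ {b ∈ T | deg' b = n.2} := by
    ext ⟨a, b⟩
    simp only [Set.mem_ofPred_eq, Set.mem_prod, Set.mem_iUnion, Finset.mem_coe,
      Finset.HasAntidiagonal.mem_antidiagonal, exists_prop, Prod.exists]
    exact ⟨fun h => ⟨_, _, h.2, ⟨h.1.1, rfl⟩, h.1.2, rfl⟩,
      fun ⟨_, _, h, ha, hb⟩ => ⟨⟨ha.1, hb.1⟩, by rw [ha.2, hb.2, h]⟩⟩
  rw [PowerSeries.coeff_mul]
  simp only [gradedSeries, PowerSeries.coeff_mk]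
  rw [hfiber, (Finset.finite_toSet _).ncard_biUnion (fun n _ => (hS n.1).prod (hT n.2)),
    finsum_mem_coe_finset]
  · simp only [Set.ncard_prod, Nat.cast_sum, Nat.cast_mul]
  · intro m _ n _ hmn
    refine Set.disjoint_left.2 fun x hm hn => hmn ?_
    exact Prod.ext (hm.1.2.symm.trans hn.1.2) (hm.2.2.symm.trans hn.2.2)

theorem gradedSeries_eq_sum {deg : α → ℕ} {S : Set α} (hS : ∀ d, {a ∈ S | deg a = d}.Finite)
    (K : Finset ι) (p : ι → α → Prop) (hp : ∀ a ∈ S, ∃! k, k ∈ K ∧ p k a) :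
    gradedSeries deg S = ∑ k ∈ K, gradedSeries deg {a ∈ S | p k a} := by
  ext d
  have hfiber : {a ∈ S | deg a = d} =
      ⋃ k ∈ (K : Set ι), {a ∈ {a ∈ S | p k a} | deg a = d} := by
    ext a
    simp only [Set.mem_ofPred_eq, Set.mem_iUnion, Finset.mem_coe, exists_prop]
    constructor
    · rintro ⟨ha, hd⟩
      obtain ⟨k, ⟨hk, hka⟩, -⟩ := hp a ha
      exact ⟨k, hk, ⟨ha, hka⟩, hd⟩
    · rintro ⟨k, -, ⟨ha, -⟩, hd⟩
      exact ⟨ha, hd⟩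
  rw [map_sum]
  simp only [gradedSeries, PowerSeries.coeff_mk]
  rw [hfiber, (Finset.finite_toSet _).ncard_biUnion
    (fun k _ => (hS d).subset fun a ha => ⟨ha.1.1, ha.2⟩), finsum_mem_coe_finset, Nat.cast_sum]
  intro k hk l hl hkl
  refine Set.disjoint_left.2 fun a hka hla => hkl ?_
  exact (hp a hka.1.1).unique ⟨hk, hka.1.2⟩ ⟨hl, hla.1.2⟩

theorem gradedSeries_sum_univ [Fintype ι] :
    gradedSeries (fun a : ι → ℕ => ∑ k, a k) Set.univ = PowerSeries.mk 1 ^ Fintype.card ι := by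
  classical
  ext d
  have hfiber : {a ∈ Set.univ | ∑ k : ι, a k = d} =
      DFunLike.coe '' ((Finset.univ.finsuppAntidiag d : Finset (ι →₀ ℕ)) : Set (ι →₀ ℕ)) := by
    ext a
    simp only [Set.mem_univ, true_and, Set.mem_image, Finset.mem_coe, Finset.mem_finsuppAntidiag,
      Finset.subset_univ, and_true, Set.mem_ofPred_eq]
    exact ⟨fun ha => ⟨Finsupp.equivFunOnFinite.symm a, ha, rfl⟩, by rintro ⟨b, hb, rfl⟩; exact hb⟩
  rw [← Finset.card_univ, ← Finset.prod_const, PowerSeries.coeff_prod]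
  simp only [gradedSeries, PowerSeries.coeff_mk, hfiber, Pi.one_apply, Finset.prod_const_one,
    Finset.sum_const, nsmul_eq_mul, mul_one]
  rw [Set.ncard_image_of_injective _ DFunLike.coe_injective, Set.ncard_coe_finset]

end GradedSeries

/-- The power series `f` equals `Q / (1 - X) ^ D` for an integer polynomial `Q` with `Q(1) = e`:
it has a pole of order at most `D` at `1`, and `e` is the leading coefficient there. -/
def HasPoleAtOne (f : PowerSeries ℤ) (D : ℕ) (e : ℤ) : Prop :=
  ∃ Q : Polynomial ℤ, f * (1 - PowerSeries.X) ^ D = (Q : PowerSeries ℤ) ∧ Q.eval 1 = e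

namespace HasPoleAtOne

variable {f g : PowerSeries ℤ} {D D' : ℕ} {e e' : ℤ}

theorem mul (hf : HasPoleAtOne f D e) (hg : HasPoleAtOne g D' e') :
    HasPoleAtOne (f * g) (D + D') (e * e') := by
  obtain ⟨P, hP, rfl⟩ := hf
  obtain ⟨Q, hQ, rfl⟩ := hg
  exact ⟨P * Q, by rw [Polynomial.coe_mul, ← hP, ← hQ]; ring, Polynomial.eval_mul⟩

theorem X_pow_mul (hf : HasPoleAtOne f D e) (n : ℕ) :
    HasPoleAtOne (PowerSeries.X ^ n * f) D e := by
  obtain ⟨Q, hQ, rfl⟩ := hf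
  exact ⟨Polynomial.X ^ n * Q, by push_cast; rw [← hQ, mul_assoc], by simp⟩

theorem sum {ι : Type*} {K : Finset ι} {F : ι → PowerSeries ℤ} {c : ι → ℤ}
    (h : ∀ k ∈ K, HasPoleAtOne (F k) D (c k)) :
    HasPoleAtOne (∑ k ∈ K, F k) D (∑ k ∈ K, c k) := by
  choose! Q hQ hc using h
  refine ⟨∑ k ∈ K, Q k, ?_, ?_⟩
  · rw [Finset.sum_mul, Finset.sum_congr rfl hQ]
    exact (map_sum Polynomial.coeToPowerSeries.ringHom Q K).symm
  · rw [Polynomial.eval_finsetSum, Finset.sum_congr rfl hc]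

theorem of_mul_one_sub_X (hf : HasPoleAtOne (f * (1 - PowerSeries.X)) D e) :
    HasPoleAtOne f (D + 1) e := by
  obtain ⟨Q, hQ, rfl⟩ := hf
  exact ⟨Q, by rw [← hQ]; ring, rfl⟩

end HasPoleAtOne

theorem degree_eq_of_hasPoleAtOne {K τ : Type*} [Field K] {I : Ideal (MvPolynomial τ K)} {D : ℕ}
    {e : ℤ} (h : HasPoleAtOne (hilbertSeries I) D e) (he : e ≠ 0) : degree I = e := by
  obtain ⟨Q, hQ, hQe⟩ := h
  have hI : HasDegree I e := ⟨D, Q, hQ, hQe, he⟩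
  have hex : ∃ e, HasDegree I e := ⟨e, hI⟩
  rw [degree, dif_pos hex]
  exact hex.choose_spec.unique hI

section MonomialMaps

open MvPolynomial
open scoped Pointwise

/-- Here `d • U` is the `d`-fold sumset `U + ⋯ + U`, not the dilate of `U`. -/
theorem closure_fiber_eq_nsmul {M : Type*} [AddCommMonoid M] {deg : M →+ ℕ} {U : Set M}
    (hU : ∀ u ∈ U, deg u = 1) (d : ℕ) :
    {u | u ∈ AddSubmonoid.closure U ∧ deg u = d} = d • U := by
  ext u
  constructor
  · rintro ⟨hu, rfl⟩
    induction hu using AddSubmonoid.closure_induction with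
    | mem u hu => rwa [hU u hu, one_nsmul]
    | zero => rw [map_zero, zero_nsmul]; exact Set.mem_zero.2 rfl
    | add u v _ _ ihu ihv => rw [map_add, add_nsmul]; exact Set.add_mem_add ihu ihv
  · induction d generalizing u with
    | zero =>
      rw [zero_nsmul, Set.mem_zero]
      rintro rfl
      exact ⟨zero_mem _, map_zero deg⟩
    | succ d ih =>
      rw [succ_nsmul]
      rintro ⟨v, hv, x, hx, rfl⟩
      exact ⟨add_mem (ih v hv).1 (AddSubmonoid.subset_closure hx),
        by rw [map_add, (ih v hv).2, hU x hx]⟩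

theorem finite_closure_fiber {M : Type*} [AddCommMonoid M] {deg : M →+ ℕ} {U : Set M}
    (hU : ∀ u ∈ U, deg u = 1) (hfin : U.Finite) (d : ℕ) :
    {u | u ∈ AddSubmonoid.closure U ∧ deg u = d}.Finite := by
  rw [closure_fiber_eq_nsmul hU]
  induction d with
  | zero => rw [zero_nsmul]; exact Set.finite_zero
  | succ d ih => rw [succ_nsmul]; exact ih.add hfin

variable {K τ ρ : Type*} [Field K]

theorem image_monomial_pow (U : Set (ρ →₀ ℕ)) (d : ℕ) :
    ((monomial · (1 : K)) '' U) ^ d = (monomial · (1 : K)) '' (d • U) := by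
  induction d with
  | zero => simp [Set.singleton_one, ← Set.singleton_zero]
  | succ d ih =>
    rw [pow_succ, ih, succ_nsmul, ← Set.image2_mul, ← Set.image2_add]
    exact (Set.image_image2_distrib fun u v => by simp [monomial_mul]).symm

theorem finrank_span_monomial (U : Set (ρ →₀ ℕ)) :
    Module.finrank K (Submodule.span K ((monomial · (1 : K)) '' U)) = U.ncard := by
  have hinj : Function.Injective fun u : ρ →₀ ℕ => monomial u (1 : K) :=
    monomial_left_injective one_ne_zero
  have hli : LinearIndependent K fun u : ρ →₀ ℕ => monomial u (1 : K) := by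
    simpa using (basisMonomials ρ K).linearIndependent
  have hrank := rank_span_set (hli.linearIndepOn_id.mono (Set.image_subset_range _ U))
  rw [Module.finrank, hrank, ← Set.ncard_image_of_injective U hinj]
  rfl

theorem hilbertFunction_ker (φ : MvPolynomial τ K →ₐ[K] MvPolynomial ρ K) (d : ℕ) :
    hilbertFunction (RingHom.ker φ) d =
      Module.finrank K ((homogeneousSubmodule τ K d).map φ.toLinearMap) := by
  have hcomp : (Ideal.kerLiftAlg φ).toLinearMap ∘ₗ
      (Ideal.Quotient.mkₐ K (RingHom.ker φ)).toLinearMap = φ.toLinearMap :=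
    LinearMap.ext fun x => Ideal.kerLiftAlg_mk φ x
  rw [← hcomp, Submodule.map_comp]
  exact (Submodule.equivMapOfInjective _ (Ideal.kerLiftAlg_injective φ) _).finrank_eq

theorem map_aeval_homogeneousSubmodule {f : τ → MvPolynomial ρ K} {U : Set (ρ →₀ ℕ)}
    (hf : Submodule.span K (Set.range f) = Submodule.span K ((monomial · (1 : K)) '' U)) (d : ℕ) :
    (homogeneousSubmodule τ K d).map (aeval f).toLinearMap =
      Submodule.span K ((monomial · (1 : K)) '' (d • U)) := by
  rw [← homogeneousSubmodule_one_pow, Submodule.map_pow, homogeneousSubmodule_one_eq_span_X,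
    Submodule.map_span, ← Set.range_comp, ← image_monomial_pow, ← Submodule.span_pow, ← hf]
  congr 3
  ext
  simp

theorem hilbertSeries_ker_aeval {f : τ → MvPolynomial ρ K} {U : Set (ρ →₀ ℕ)}
    (hf : Submodule.span K (Set.range f) = Submodule.span K ((monomial · (1 : K)) '' U))
    {deg : (ρ →₀ ℕ) →+ ℕ} (hU : ∀ u ∈ U, deg u = 1) :
    hilbertSeries (RingHom.ker (aeval f : MvPolynomial τ K →ₐ[K] MvPolynomial ρ K)) =
      gradedSeries deg (AddSubmonoid.closure U : Set (ρ →₀ ℕ)) := by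
  ext d
  simp only [hilbertSeries, gradedSeries, PowerSeries.coeff_mk, SetLike.mem_coe]
  rw [hilbertFunction_ker, map_aeval_homogeneousSubmodule hf, finrank_span_monomial,
    closure_fiber_eq_nsmul hU]

end MonomialMaps

end HilbertDegree

namespace BayesNet

open Relation HilbertDegree

variable {V : Type*}

/-! ### Downward forests -/

section Digraphs

variable {G : Digraph V} {t u v w : V}

theorem skeleton_adj : (skeleton G).Adj u v ↔ u ≠ v ∧ (G.Adj u v ∨ G.Adj v u) :=
  SimpleGraph.fromRel_adj _ _ _

theorem reachable_of_reaches (h : ReflTransGen G.Adj u v) : (skeleton G).Reachable u v := by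
  induction h with
  | refl => exact .refl _
  | @tail v w _ hvw ih =>
    by_cases hne : v = w
    · exact hne ▸ ih
    · exact ih.trans (skeleton_adj.2 ⟨hne, Or.inl hvw⟩ : (skeleton G).Adj v w).reachable

theorem IsDAG.ne_of_adj (hG : IsDAG G) (h : G.Adj u v) : u ≠ v := by
  rintro rfl
  exact hG u (.single h)

theorem IsDAG.not_reaches_of_adj (hG : IsDAG G) (h : G.Adj u v) : ¬ ReflTransGen G.Adj v u :=
  fun hvu => hG u (.head' h hvu)

theorem IsDAG.wellFounded_transGen [Finite V] (hG : IsDAG G) : WellFounded (TransGen G.Adj) :=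
  haveI : Std.Irrefl (TransGen G.Adj) := ⟨hG⟩
  Finite.wellFounded_of_trans_of_irrefl _

theorem IsDAG.exists_source [Finite V] (hG : IsDAG G) (v : V) :
    ∃ i, IsSource G i ∧ ReflTransGen G.Adj i v := by
  induction v using hG.wellFounded_transGen.induction with
  | _ v ih =>
    by_cases hv : IsSource G v
    · exact ⟨v, hv, .refl⟩
    · simp only [IsSource, not_forall, not_not] at hv
      obtain ⟨u, huv⟩ := hv
      obtain ⟨i, hi, hiu⟩ := ih u (.single huv)
      exact ⟨i, hi, hiu.tail huv⟩

theorem IsDAG.exists_sink [Finite V] (hG : IsDAG G) (v : V) :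
    ∃ t, IsSink G t ∧ ReflTransGen G.Adj v t := by
  have hrev : IsDAG (⟨fun u v => G.Adj v u⟩ : Digraph V) := fun v h => hG v (transGen_swap.1 h)
  obtain ⟨t, ht, htv⟩ := hrev.exists_source v
  exact ⟨t, ht, reflTransGen_swap.1 htv⟩

theorem IsSink.not_transGen (ht : IsSink G t) : ¬ TransGen G.Adj t v := fun h => by
  obtain ⟨x, hx, -⟩ := TransGen.head'_iff.1 h
  exact ht x hx

theorem IsSink.eq_of_reaches (ht : IsSink G t) (h : ReflTransGen G.Adj t v) : v = t :=
  (reflTransGen_iff_eq_or_transGen.1 h).resolve_right ht.not_transGen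

theorem deleteEdge_le (G : Digraph V) (e : V × V) : deleteEdge G e ≤ G := fun _ _ h => h.1

theorem IsDAG.isBridge_iff (hG : IsDAG G) (huv : G.Adj u v) :
    (skeleton G).IsBridge s(u, v) ↔ ¬ (skeleton (deleteEdge G (u, v))).Reachable u v := by
  have hskeleton : (skeleton G).deleteEdges {s(u, v)} = skeleton (deleteEdge G (u, v)) := by
    ext x y
    have hvu : ¬ G.Adj v u := fun h => hG.not_reaches_of_adj huv (.single h)
    simp only [SimpleGraph.deleteEdges_adj, skeleton_adj, Set.mem_singleton_iff, deleteEdge,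
      Sym2.eq_iff, ne_eq, Prod.mk.injEq]
    grind
  rw [SimpleGraph.isBridge_iff, hskeleton]

theorem IsDAG.not_reachable_deleteEdge (hG : IsDAG G) (hacyclic : (skeleton G).IsAcyclic)
    (huv : G.Adj u v) : ¬ (skeleton (deleteEdge G (u, v))).Reachable u v :=
  (hG.isBridge_iff huv).1 <| SimpleGraph.isAcyclic_iff_forall_adj_isBridge.1 hacyclic <|
    skeleton_adj.2 ⟨hG.ne_of_adj huv, Or.inl huv⟩

theorem card_edge_deleteEdge [Finite V] (e : Edge G) :
    Nat.card (Edge (deleteEdge G e.1)) + 1 = Nat.card (Edge G) := by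
  have hset : {p : V × V | (deleteEdge G e.1).Adj p.1 p.2} =
      {p : V × V | G.Adj p.1 p.2} \ {e.1} := rfl
  change Nat.card {p : V × V | (deleteEdge G e.1).Adj p.1 p.2} + 1 =
    Nat.card {p : V × V | G.Adj p.1 p.2}
  rw [Nat.card_coe_set_eq, Nat.card_coe_set_eq, hset]
  exact Set.ncard_sdiff_singleton_add_one e.2

end Digraphs

/-- A downward forest: a directed acyclic graph in which every vertex has at most one outgoing
edge. These are the disjoint unions of downward directed trees. -/
structure IsDownwardForest (G : Digraph V) : Prop where
  dag : IsDAG G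
  rightUnique : Relator.RightUnique G.Adj

namespace IsDownwardForest

variable {G H : Digraph V} {i j k l t u v w : V}

theorem mono (hG : IsDownwardForest G) (hHG : H ≤ G) : IsDownwardForest H where
  dag v hv := hG.dag v (TransGen.mono hHG _ _ hv)
  rightUnique _ _ _ h h' := hG.rightUnique (hHG h) (hHG h')

theorem reaches_of_transGen (hG : IsDownwardForest G) (h : G.Adj u v)
    (huw : TransGen G.Adj u w) : ReflTransGen G.Adj v w := by
  obtain ⟨x, hx, hxw⟩ := TransGen.head'_iff.1 huw
  rwa [hG.rightUnique h hx]

theorem transGen_iff (hG : IsDownwardForest G) (h : G.Adj u v) :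
    TransGen G.Adj u w ↔ ReflTransGen G.Adj v w :=
  ⟨hG.reaches_of_transGen h, .head' h⟩

theorem reaches_iff (hG : IsDownwardForest G) (h : G.Adj u v) :
    ReflTransGen G.Adj u w ↔ w = u ∨ ReflTransGen G.Adj v w := by
  rw [reflTransGen_iff_eq_or_transGen, hG.transGen_iff h]

theorem eq_of_reaches_of_adj (hG : IsDownwardForest G) (hu : ReflTransGen G.Adj i u)
    (hw : ReflTransGen G.Adj i w) (huv : G.Adj u v) (hwv : G.Adj w v) : u = w := by
  rcases ReflTransGen.total_of_right_unique hG.rightUnique hu hw with huw | hwu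
  · rcases reflTransGen_iff_eq_or_transGen.1 huw with rfl | huw
    · rfl
    · exact absurd (hG.reaches_of_transGen huv huw) (hG.dag.not_reaches_of_adj hwv)
  · rcases reflTransGen_iff_eq_or_transGen.1 hwu with rfl | hwu
    · rfl
    · exact absurd (hG.reaches_of_transGen hwv hwu) (hG.dag.not_reaches_of_adj huv)

theorem reaches_of_reachable (hG : IsDownwardForest G) (ht : IsSink G t)
    (h : (skeleton G).Reachable t w) : ReflTransGen G.Adj w t := by
  rw [SimpleGraph.reachable_iff_reflTransGen] at h
  induction h with
  | refl => exact .refl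
  | tail _ hadj ih =>
    rcases (skeleton_adj.1 hadj).2 with hvw | hwv
    · rcases reflTransGen_iff_eq_or_transGen.1 ih with rfl | hvt
      · exact absurd hvw (ht _)
      · exact hG.reaches_of_transGen hvw hvt
    · exact ih.head hwv

theorem edge_ext (hG : IsDownwardForest G) {e f : Edge G} (h : e.1.1 = f.1.1) : e = f :=
  Subtype.ext (Prod.ext h (hG.rightUnique e.2 (h ▸ f.2)))

theorem isSink_deleteEdge_iff (hG : IsDownwardForest G) (hkl : G.Adj k l) :
    IsSink (deleteEdge G (k, l)) v ↔ IsSink G v ∨ v = k := by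
  constructor
  · intro hv
    by_contra! hne
    obtain ⟨w, hw⟩ := not_forall_not.1 hne.1
    exact hv w ⟨hw, fun h => hne.2 (congrArg Prod.fst h)⟩
  · rintro (hv | rfl) w ⟨hw, hne⟩
    · exact hv w hw
    · exact hne (by rw [hG.rightUnique hw hkl])

theorem deleteEdge_adj_iff (hG : IsDownwardForest G) (hkl : G.Adj k l) :
    (deleteEdge G (k, l)).Adj u v ↔ G.Adj u v ∧ u ≠ k := by
  refine and_congr_right fun huv => not_congr ⟨congrArg Prod.fst, ?_⟩
  rintro rfl
  rw [hG.rightUnique huv hkl]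

/-- Deleting an edge `u → v` turns `u` into a sink, so an undirected path from `v` back to `u`
would be a directed one, closing a cycle. -/
theorem isAcyclic_skeleton (hG : IsDownwardForest G) : (skeleton G).IsAcyclic := by
  have hbridge {u v : V} (huv : G.Adj u v) : (skeleton G).IsBridge s(u, v) := by
    rw [hG.dag.isBridge_iff huv]
    intro hreach
    have hvu := (hG.mono (deleteEdge_le G (u, v))).reaches_of_reachable
      ((hG.isSink_deleteEdge_iff huv).2 (Or.inr rfl)) hreach
    exact hG.dag.not_reaches_of_adj huv (ReflTransGen.mono (deleteEdge_le G (u, v)) _ _ hvu)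
  rw [SimpleGraph.isAcyclic_iff_forall_adj_isBridge]
  intro u v huv
  rcases (skeleton_adj.1 huv).2 with h | h
  · exact hbridge h
  · exact Sym2.eq_swap (a := u) ▸ hbridge h

end IsDownwardForest

/-! ### Flows -/

/-- The edges on the directed walk from `i` to `j`. -/
def walkEdges [Finite V] (G : Digraph V) (i j : V) : Finset (Edge G) :=
  (Set.toFinite {e : Edge G |
    ReflTransGen G.Adj i e.1.1 ∧ ReflTransGen G.Adj e.1.2 j}).toFinset

theorem mem_walkEdges [Finite V] {G : Digraph V} {i j : V} {e : Edge G} :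
    e ∈ walkEdges G i j ↔ ReflTransGen G.Adj i e.1.1 ∧ ReflTransGen G.Adj e.1.2 j := by
  simp [walkEdges]

theorem IsDownwardForest.reaches_iff_mem_tails [Finite V] [DecidableEq V] {G : Digraph V}
    {i k t : V} (hG : IsDownwardForest G) (ht : IsSink G t)
    (hit : ReflTransGen G.Adj i t) :
    ReflTransGen G.Adj i k ↔ k ∈ insert t ((walkEdges G i t).image fun e => e.1.1) := by
  simp only [Finset.mem_insert, Finset.mem_image, mem_walkEdges]
  constructor
  · intro hik
    rcases ReflTransGen.total_of_right_unique hG.rightUnique hik hit with hkt | htk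
    · rcases hkt.cases_head with rfl | ⟨l, hkl, hlt⟩
      · exact Or.inl rfl
      · exact Or.inr ⟨⟨(k, l), hkl⟩, ⟨hik, hlt⟩, rfl⟩
    · exact Or.inl (ht.eq_of_reaches htk)
  · rintro (rfl | ⟨e, ⟨hie, -⟩, rfl⟩)
    exacts [hit, hie]

section UnitFlows

variable {G : Digraph V} {i j k l u v : V} {y : V → ℕ}

open Classical in
/-- The flow of one unit along the directed walk from `i` to `j`, where it disappears. -/
def unitFlow (G : Digraph V) (i j : V) : (V → ℕ) × (V → ℕ) :=
  (Pi.single i 1, fun v => if ReflTransGen G.Adj i v ∧ TransGen G.Adj v j then 1 else 0)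

theorem unitFlow_fst [DecidableEq V] (G : Digraph V) (i j : V) :
    (unitFlow G i j).1 = Pi.single i 1 := by
  ext v
  simp only [unitFlow, Pi.single_apply]
  congr

theorem unitFlow_snd_of_reaches (hv : ReflTransGen G.Adj i v) (hvj : TransGen G.Adj v j) :
    (unitFlow G i j).2 v = 1 := if_pos ⟨hv, hvj⟩

theorem unitFlow_snd_of_not_transGen (hvj : ¬ TransGen G.Adj v j) : (unitFlow G i j).2 v = 0 :=
  if_neg fun h => hvj h.2

theorem IsDAG.unitFlow_snd_self (hG : IsDAG G) (i : V) : (unitFlow G i i).2 = 0 :=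
  funext fun v => if_neg fun h => hG v (h.2.trans_left h.1)

theorem IsDownwardForest.unitFlow_snd_of_adj [DecidableEq V] (hG : IsDownwardForest G)
    (hil : G.Adj i l) (hlj : ReflTransGen G.Adj l j) :
    (unitFlow G i j).2 = Pi.single i 1 + (unitFlow G l j).2 := by
  funext v
  by_cases hvi : v = i
  · subst hvi
    rw [unitFlow_snd_of_reaches .refl (.head' hil hlj)]
    simp [unitFlow, hG.dag.not_reaches_of_adj hil]
  · have hiff : ReflTransGen G.Adj i v ↔ ReflTransGen G.Adj l v := by
      refine ⟨fun h => ?_, fun h => h.head hil⟩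
      exact hG.reaches_of_transGen hil ((reflTransGen_iff_eq_or_transGen.1 h).resolve_left hvi)
    simp only [unitFlow, Pi.add_apply, Pi.single_eq_of_ne hvi, zero_add]
    rw [hiff]

/-- The flows of one unit along directed walks. -/
def unitFlows (G : Digraph V) : Set ((V → ℕ) × (V → ℕ)) :=
  {w | ∃ i j, ReflTransGen G.Adj i j ∧ unitFlow G i j = w}

theorem finite_unitFlows [Finite V] (G : Digraph V) : (unitFlows G).Finite :=
  (Set.finite_range fun p : V × V => unitFlow G p.1 p.2).subset
    fun _ ⟨i, j, _, h⟩ => ⟨(i, j), h⟩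

/-- The vertex `k` is the first one on the directed walk starting at `i` that no flow leaves. -/
structure StopsAt (G : Digraph V) (y : V → ℕ) (i k : V) : Prop where
  reaches : ReflTransGen G.Adj i k
  eq_zero : y k = 0
  pos : ∀ u, ReflTransGen G.Adj i u → TransGen G.Adj u k → 0 < y u

theorem IsDAG.stopsAt_self_iff (hG : IsDAG G) : StopsAt G y i i ↔ y i = 0 :=
  ⟨StopsAt.eq_zero, fun h => ⟨.refl, h, fun u hiu hui => absurd (hui.trans_left hiu) (hG u)⟩⟩

theorem IsDownwardForest.exists_stopsAt [Finite V] (hG : IsDownwardForest G)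
    (hy : ∀ v, IsSink G v → y v = 0) (i : V) : ∃ k, StopsAt G y i k := by
  obtain ⟨t, ht, hit⟩ := hG.dag.exists_sink i
  induction hit using ReflTransGen.head_induction_on with
  | refl => exact ⟨t, hG.dag.stopsAt_self_iff.2 (hy t ht)⟩
  | @head i x hix _ ih =>
    by_cases hi : y i = 0
    · exact ⟨i, hG.dag.stopsAt_self_iff.2 hi⟩
    · obtain ⟨k, hk⟩ := ih
      refine ⟨k, hk.reaches.head hix, hk.eq_zero, fun u hiu huk => ?_⟩
      rcases reflTransGen_iff_eq_or_transGen.1 hiu with rfl | hiu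
      · exact Nat.pos_of_ne_zero hi
      · exact hk.pos u (hG.reaches_of_transGen hix hiu) huk

theorem StopsAt.unique (hG : Relator.RightUnique G.Adj) (hk : StopsAt G y i k)
    (hl : StopsAt G y i l) : k = l := by
  rcases ReflTransGen.total_of_right_unique hG hk.reaches hl.reaches with h | h <;>
    rcases reflTransGen_iff_eq_or_transGen.1 h with rfl | h
  · rfl
  · exact absurd hk.eq_zero (hl.pos k hk.reaches h).ne'
  · rfl
  · exact absurd hl.eq_zero (hk.pos l hl.reaches h).ne'

end UnitFlows

section Flows

variable [Fintype V] {G H : Digraph V} {i j k l t u v : V} {y z : V → ℕ}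
  {w : (V → ℕ) × (V → ℕ)}

open Classical in
/-- The amount of flow entering the vertex `v`, when `y u` is the flow leaving `u` along its
outgoing edge. -/
def inflow (G : Digraph V) (y : V → ℕ) (v : V) : ℕ :=
  ∑ u with G.Adj u v, y u

theorem inflow_zero (G : Digraph V) (v : V) : inflow G 0 v = 0 := Finset.sum_const_zero

theorem inflow_add (G : Digraph V) (y z : V → ℕ) (v : V) :
    inflow G (y + z) v = inflow G y v + inflow G z v := by
  classical exact Finset.sum_add_distrib

theorem inflow_eq_zero (h : ∀ u, G.Adj u v → y u = 0) : inflow G y v = 0 := by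
  classical exact Finset.sum_eq_zero fun u hu => h u (Finset.mem_filter.1 hu).2

theorem IsDownwardForest.inflow_single [DecidableEq V] (hG : IsDownwardForest G)
    (hkl : G.Adj k l) (v : V) :
    inflow G (Pi.single k 1) v = Pi.single (M := fun _ => ℕ) l 1 v := by
  classical
  have hiff : G.Adj k v ↔ v = l := ⟨fun h => hG.rightUnique h hkl, fun h => h ▸ hkl⟩
  simp [inflow, Pi.single_apply, hiff]

/-- The monoid of flows on `G`. A flow is a pair `(α, y)`, where `α v` is the amount entering the
network at the vertex `v` and `y v` is the amount leaving `v` along its outgoing edge; flow may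
disappear, but not emerge, on its way. -/
def flowMonoid (G : Digraph V) : AddSubmonoid ((V → ℕ) × (V → ℕ)) where
  carrier := {w | (∀ v, IsSink G v → w.2 v = 0) ∧ ∀ v, w.2 v ≤ w.1 v + inflow G w.2 v}
  zero_mem' := ⟨fun _ _ => rfl, fun _ => Nat.zero_le _⟩
  add_mem' {w w'} hw hw' := by
    refine ⟨fun v hv => ?_, fun v => ?_⟩
    · simp [hw.1 v hv, hw'.1 v hv]
    · have := hw.2 v
      have := hw'.2 v
      simp only [Prod.fst_add, Prod.snd_add, Pi.add_apply, inflow_add]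
      omega

theorem mem_flowMonoid : w ∈ flowMonoid G ↔
    (∀ v, IsSink G v → w.2 v = 0) ∧ ∀ v, w.2 v ≤ w.1 v + inflow G w.2 v := Iff.rfl

/-- The total amount entering the network. -/
def amount : (V → ℕ) × (V → ℕ) →+ ℕ where
  toFun w := ∑ v, w.1 v
  map_zero' := Finset.sum_const_zero
  map_add' _ _ := Finset.sum_add_distrib

theorem amount_apply (w : (V → ℕ) × (V → ℕ)) : amount w = ∑ v, w.1 v := rfl

theorem IsDAG.eq_zero_of_amount_eq_zero (hG : IsDAG G) (hw : w ∈ flowMonoid G)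
    (hw0 : amount w = 0) : w = 0 := by
  have hα : ∀ v, w.1 v = 0 := fun v => Finset.sum_eq_zero_iff.1 hw0 v (Finset.mem_univ v)
  refine Prod.ext (funext hα) (funext fun v => ?_)
  induction v using hG.wellFounded_transGen.induction with
  | _ v ih =>
    have hin : inflow G w.2 v = 0 := inflow_eq_zero fun u huv => ih u (.single huv)
    have := hw.2 v
    rwa [hα, hin, Nat.le_zero] at this

theorem amount_unitFlow (G : Digraph V) (i j : V) : amount (unitFlow G i j) = 1 := by
  classical
  simp [amount_apply, unitFlow_fst]

theorem IsDownwardForest.unitFlow_conservation [DecidableEq V] (hG : IsDownwardForest G)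
    (hij : ReflTransGen G.Adj i j) (v : V) :
    (unitFlow G i j).1 v + inflow G (unitFlow G i j).2 v =
      (unitFlow G i j).2 v + Pi.single (M := fun _ => ℕ) j 1 v := by
  induction hij using ReflTransGen.head_induction_on with
  | refl => simp [hG.dag.unitFlow_snd_self, inflow_zero, unitFlow_fst]
  | head hil hlj ih =>
    rw [hG.unitFlow_snd_of_adj hil hlj, inflow_add, hG.inflow_single hil, Pi.add_apply, add_assoc,
      ← ih, unitFlow_fst, unitFlow_fst]

theorem IsDownwardForest.unitFlow_mem_flowMonoid (hG : IsDownwardForest G)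
    (hij : ReflTransGen G.Adj i j) : unitFlow G i j ∈ flowMonoid G :=
  ⟨fun _ hv => unitFlow_snd_of_not_transGen hv.not_transGen,
    fun v => by classical exact (Nat.le_add_right _ _).trans (hG.unitFlow_conservation hij v).ge⟩

theorem IsDownwardForest.exists_add_unitFlow_eq (hG : IsDownwardForest G)
    (hw : w ∈ flowMonoid G) (hi : 0 < w.1 i) (hk : StopsAt G w.2 i k) :
    ∃ w' ∈ flowMonoid G, w' + unitFlow G i k = w := by
  classical
  have hle : unitFlow G i k ≤ w := by
    refine ⟨fun v => ?_, fun v => ?_⟩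
    · obtain rfl | hvi := eq_or_ne v i
      · rw [unitFlow_fst, Pi.single_eq_same]
        exact hi
      · simp [unitFlow_fst, hvi]
    · simp only [unitFlow]
      split_ifs with hv
      exacts [hk.pos v hv.1 hv.2, Nat.zero_le _]
  obtain ⟨w', rfl⟩ := exists_add_of_le hle
  rw [add_comm] at hw hk
  refine ⟨w', ⟨fun v hv => (Nat.add_eq_zero_iff.1 (hw.1 v hv)).1, fun v => ?_⟩, add_comm _ _⟩
  by_cases hvk : v = k
  · rw [hvk, (Nat.add_eq_zero_iff.1 hk.eq_zero).1]
    exact Nat.zero_le _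
  · have hflow := hw.2 v
    have hunit := hG.unitFlow_conservation hk.reaches v
    simp only [Prod.fst_add, Prod.snd_add, Pi.add_apply, inflow_add, Pi.single_eq_of_ne hvk]
      at hflow hunit
    omega

theorem IsDownwardForest.closure_unitFlows (hG : IsDownwardForest G) :
    AddSubmonoid.closure (unitFlows G) = flowMonoid G := by
  refine le_antisymm (AddSubmonoid.closure_le.2 ?_) fun w hw => ?_
  · rintro _ ⟨i, j, hij, rfl⟩
    exact hG.unitFlow_mem_flowMonoid hij
  · induction hd : amount w generalizing w with
    | zero => exact hG.dag.eq_zero_of_amount_eq_zero hw hd ▸ zero_mem _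
    | succ d ih =>
      obtain ⟨i, -, hi⟩ : ∃ i ∈ Finset.univ, w.1 i ≠ 0 :=
        Finset.exists_ne_zero_of_sum_ne_zero (hd.trans_ne d.succ_ne_zero)
      obtain ⟨k, hk⟩ := hG.exists_stopsAt hw.1 i
      obtain ⟨w', hw', rfl⟩ := hG.exists_add_unitFlow_eq hw (Nat.pos_of_ne_zero hi) hk
      rw [map_add, amount_unitFlow, Nat.add_right_cancel_iff] at hd
      exact add_mem (ih w' hw' hd) (AddSubmonoid.subset_closure ⟨i, k, hk.reaches, rfl⟩)

theorem IsDownwardForest.finite_flows (hG : IsDownwardForest G) (d : ℕ) :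
    {w | w ∈ flowMonoid G ∧ amount w = d}.Finite := by
  rw [← hG.closure_unitFlows]
  refine finite_closure_fiber ?_ (finite_unitFlows G) d
  rintro _ ⟨i, j, -, rfl⟩
  exact amount_unitFlow G i j

end Flows

/-! ### The recursion for the generating series of flows -/

section FlowSeries

variable [Fintype V] {G : Digraph V} {i k l t : V}

/-- The generating series of the flows on `G`, counted by their amount. -/
def flowSeries (G : Digraph V) : PowerSeries ℤ :=
  gradedSeries amount (flowMonoid G : Set ((V → ℕ) × (V → ℕ)))

namespace IsDownwardForest

theorem inflow_deleteEdge (hG : IsDownwardForest G) (hkl : G.Adj k l) {y : V → ℕ} (hk : y k = 0)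
    (v : V) : inflow (deleteEdge G (k, l)) y v = inflow G y v := by
  classical
  simp only [inflow, Finset.sum_filter, hG.deleteEdge_adj_iff hkl]
  refine Finset.sum_congr rfl fun u _ => ?_
  by_cases hu : u = k <;> simp [hu, hk]

theorem flowMonoid_deleteEdge (hG : IsDownwardForest G) (hkl : G.Adj k l) :
    (flowMonoid (deleteEdge G (k, l)) : Set ((V → ℕ) × (V → ℕ))) =
      {w ∈ (flowMonoid G : Set ((V → ℕ) × (V → ℕ))) | w.2 k = 0} := by
  ext w
  simp only [SetLike.mem_coe, Set.mem_ofPred_eq, mem_flowMonoid, hG.isSink_deleteEdge_iff hkl]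
  constructor
  · rintro ⟨hsink, hle⟩
    have hk := hsink k (Or.inr rfl)
    exact ⟨⟨fun v hv => hsink v (Or.inl hv), fun v => hG.inflow_deleteEdge hkl hk v ▸ hle v⟩, hk⟩
  · rintro ⟨⟨hsink, hle⟩, hk⟩
    refine ⟨fun v hv => hv.elim (hsink v) (· ▸ hk), fun v => ?_⟩
    exact (hG.inflow_deleteEdge hkl hk v).symm ▸ hle v

theorem setOf_stopsAt_eq_image (hG : IsDownwardForest G) (hi : IsSource G i)
    (hik : TransGen G.Adj i k) :
    {w ∈ (flowMonoid G : Set ((V → ℕ) × (V → ℕ))) | StopsAt G w.2 i k} =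
      (· + unitFlow G i k) '' {w ∈ (flowMonoid G : Set ((V → ℕ) × (V → ℕ))) | w.2 k = 0} := by
  ext w
  constructor
  · rintro ⟨hw, hk⟩
    have hpos : 0 < w.1 i := by
      have hle := hw.2 i
      rw [inflow_eq_zero fun u hu => absurd hu (hi u), add_zero] at hle
      exact (hk.pos i .refl hik).trans_le hle
    obtain ⟨w', hw', rfl⟩ := hG.exists_add_unitFlow_eq hw hpos hk
    exact ⟨w', ⟨hw', (Nat.add_eq_zero_iff.1 hk.eq_zero).1⟩, rfl⟩
  · rintro ⟨w', ⟨hw', hk⟩, rfl⟩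
    refine ⟨add_mem hw' (hG.unitFlow_mem_flowMonoid hik.to_reflTransGen), hik.to_reflTransGen,
      ?_, fun u hiu huk => ?_⟩
    · exact Nat.add_eq_zero_iff.2 ⟨hk, unitFlow_snd_of_not_transGen (hG.dag k)⟩
    · exact Nat.add_pos_right _ (unitFlow_snd_of_reaches hiu huk).ge

theorem gradedSeries_stopsAt [DecidableEq V] (hG : IsDownwardForest G) (hi : IsSource G i)
    (hik : ReflTransGen G.Adj i k) :
    gradedSeries amount {w ∈ (flowMonoid G : Set ((V → ℕ) × (V → ℕ))) | StopsAt G w.2 i k} =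
      PowerSeries.X ^ (if k = i then 0 else 1) *
        gradedSeries amount {w ∈ (flowMonoid G : Set ((V → ℕ) × (V → ℕ))) | w.2 k = 0} := by
  split_ifs with hki
  · simp only [hki, hG.dag.stopsAt_self_iff, pow_zero, one_mul]
  · have hik := (reflTransGen_iff_eq_or_transGen.1 hik).resolve_left hki
    rw [hG.setOf_stopsAt_eq_image hi hik, gradedSeries_image (add_left_injective _).injOn,
      ← gradedSeries_add_const]
    congr 1
    funext w
    simp only [Function.comp_apply, map_add, amount_unitFlow]

/-- Classify the flows by the vertex at which the flow starting at `i` stops. Those that stop at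
the sink `t` contribute `X * flowSeries G`. -/
theorem flowSeries_mul_one_sub_X [DecidableEq V] (hG : IsDownwardForest G) (hi : IsSource G i)
    (ht : IsSink G t) (hit : TransGen G.Adj i t) :
    flowSeries G * (1 - PowerSeries.X) =
      ∑ e ∈ walkEdges G i t,
        PowerSeries.X ^ (if e.1.1 = i then 0 else 1) * flowSeries (deleteEdge G e.1) := by
  have hti : t ≠ i := by rintro rfl; exact hG.dag t hit
  have hmem {k : V} := hG.reaches_iff_mem_tails (k := k) ht hit.to_reflTransGen
  have hpartition := gradedSeries_eq_sum hG.finite_flows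
    (insert t ((walkEdges G i t).image fun e => e.1.1)) (fun k w => StopsAt G w.2 i k)
    fun w hw => by
      obtain ⟨k, hk⟩ := hG.exists_stopsAt hw.1 i
      exact ⟨k, ⟨hmem.1 hk.reaches, hk⟩, fun l hl => hl.2.unique hG.rightUnique hk⟩
  rw [Finset.sum_congr rfl fun k hk => hG.gradedSeries_stopsAt hi (hmem.2 hk),
    Finset.sum_insert, Finset.sum_image fun e _ f _ => hG.edge_ext] at hpartition
  · have hsink : {w ∈ (flowMonoid G : Set ((V → ℕ) × (V → ℕ))) | w.2 t = 0} = flowMonoid G :=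
      Set.sep_eq_self_iff_mem_true.2 fun w hw => hw.1 t ht
    rw [hsink, if_neg hti, pow_one] at hpartition
    rw [mul_sub, mul_one, sub_eq_iff_eq_add', mul_comm]
    refine hpartition.trans (congrArg _ (Finset.sum_congr rfl fun e _ => ?_))
    rw [flowSeries, hG.flowMonoid_deleteEdge e.2]
  · intro hmem
    obtain ⟨e, -, rfl⟩ := Finset.mem_image.1 hmem
    exact ht _ e.2

theorem hasPoleAtOne_flowSeries_of_walkEdges (hG : IsDownwardForest G) (hi : IsSource G i)
    (ht : IsSink G t) (hit : TransGen G.Adj i t) {D : ℕ} {c : Edge G → ℤ}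
    (hc : ∀ e ∈ walkEdges G i t, HasPoleAtOne (flowSeries (deleteEdge G e.1)) D (c e)) :
    HasPoleAtOne (flowSeries G) (D + 1) (∑ e ∈ walkEdges G i t, c e) := by
  classical
  refine .of_mul_one_sub_X ?_
  rw [hG.flowSeries_mul_one_sub_X hi ht hit]
  exact .sum fun e he => (hc e he).X_pow_mul _

end IsDownwardForest

theorem flowSeries_of_forall_not_adj (hG : ∀ u v, ¬ G.Adj u v) :
    flowSeries G = PowerSeries.mk 1 ^ Fintype.card V := by
  have himage : (flowMonoid G : Set ((V → ℕ) × (V → ℕ))) = (·, 0) '' Set.univ := by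
    ext w
    refine ⟨fun hw => ⟨w.1, trivial, Prod.ext rfl (funext fun v => (hw.1 v (hG v)).symm)⟩, ?_⟩
    rintro ⟨α, -, rfl⟩
    exact ⟨fun _ _ => rfl, fun _ => Nat.zero_le _⟩
  rw [flowSeries, himage, gradedSeries_image (Prod.mk_left_injective 0).injOn]
  exact gradedSeries_sum_univ

theorem hasPoleAtOne_flowSeries_of_forall_not_adj (hG : ∀ u v, ¬ G.Adj u v) :
    HasPoleAtOne (flowSeries G) (Fintype.card V) 1 := by
  refine ⟨1, ?_, Polynomial.eval_one⟩
  rw [flowSeries_of_forall_not_adj hG, ← mul_pow, PowerSeries.mk_one_mul_one_sub_eq_one, one_pow,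
    Polynomial.coe_one]

theorem IsDownwardForest.exists_hasPoleAtOne_flowSeries (hG : IsDownwardForest G) :
    ∃ c : ℤ, 0 < c ∧ HasPoleAtOne (flowSeries G) (Fintype.card V + Nat.card (Edge G)) c := by
  induction hn : Nat.card (Edge G) generalizing G with
  | zero =>
    refine ⟨1, one_pos, hasPoleAtOne_flowSeries_of_forall_not_adj fun u v huv => ?_⟩
    exact (Finite.card_eq_zero_iff.1 hn).false ⟨(u, v), huv⟩
  | succ n ih =>
    obtain ⟨⟨⟨k, l⟩, hkl⟩⟩ := (Nat.card_pos_iff.1 (n.succ_pos.trans_eq hn.symm)).1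
    obtain ⟨i, hi, hik⟩ := hG.dag.exists_source k
    obtain ⟨t, ht, hlt⟩ := hG.dag.exists_sink l
    have hdelete (e : Edge G) := ih (hG.mono (deleteEdge_le G e.1))
      (Nat.succ_injective ((card_edge_deleteEdge e).trans hn))
    choose c hcpos hc using hdelete
    refine ⟨∑ e ∈ walkEdges G i t, c e, ?_,
      hG.hasPoleAtOne_flowSeries_of_walkEdges hi ht (.trans_right hik (.head' hkl hlt))
        fun e _ => hc e⟩
    exact Finset.sum_pos (fun e _ => hcpos e) ⟨⟨(k, l), hkl⟩, mem_walkEdges.2 ⟨hik, hlt⟩⟩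

end FlowSeries

/-! ### Treks and the Hilbert series -/

section Treks

variable {G : Digraph V} {a b i j : V}

/-- The walk `p` runs along the directed walk from `i` to `j`, in either direction. -/
structure Traces (G : Digraph V) (i j : V) {a b : V} (p : (skeleton G).Walk a b) : Prop where
  isPath : p.IsPath
  mem_support_iff : ∀ v, v ∈ p.support ↔ ReflTransGen G.Adj i v ∧ ReflTransGen G.Adj v j
  uses_iff : ∀ k l, Uses G p k l ↔ ReflTransGen G.Adj i k ∧ G.Adj k l ∧ ReflTransGen G.Adj l j

theorem Traces.reverse {p : (skeleton G).Walk a b} (hp : Traces G i j p) :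
    Traces G i j p.reverse where
  isPath := hp.isPath.reverse
  mem_support_iff v := by simpa using hp.mem_support_iff v
  uses_iff k l := by simpa [Uses] using hp.uses_iff k l

theorem uses_cons_iff {x k l : V} {h : (skeleton G).Adj a x} {p : (skeleton G).Walk x b} :
    Uses G (.cons h p) k l ↔
      G.Adj k l ∧ (k = a ∧ l = x ∨ k = x ∧ l = a) ∨ Uses G p k l := by
  simp only [Uses, SimpleGraph.Walk.edges_cons, List.mem_cons, Sym2.eq_iff, and_or_left]

theorem IsDAG.traces_nil (hG : IsDAG G) (i : V) :
    Traces G i i (.nil : (skeleton G).Walk i i) where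
  isPath := .nil
  mem_support_iff v := by
    rw [SimpleGraph.Walk.support_nil, List.mem_singleton]
    refine ⟨by rintro rfl; exact ⟨.refl, .refl⟩, fun ⟨hiv, hvi⟩ => ?_⟩
    exact (reflTransGen_iff_eq_or_transGen.1 hiv).resolve_right fun h => hG i (h.trans_left hvi)
  uses_iff k l := ⟨fun h => absurd h.2 List.not_mem_nil,
    fun ⟨hik, hkl, hli⟩ => absurd (hli.trans hik) (hG.not_reaches_of_adj hkl)⟩

namespace IsDownwardForest

theorem traces_cons (hG : IsDownwardForest G) {x : V} (hix : G.Adj i x)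
    (hxj : ReflTransGen G.Adj x j) {p : (skeleton G).Walk x b} (hp : Traces G x j p) :
    Traces G i j (.cons (skeleton_adj.2 ⟨hG.dag.ne_of_adj hix, Or.inl hix⟩) p) where
  isPath := by
    rw [SimpleGraph.Walk.cons_isPath_iff, hp.mem_support_iff]
    exact ⟨hp.isPath, fun h => hG.dag.not_reaches_of_adj hix h.1⟩
  mem_support_iff v := by
    rw [SimpleGraph.Walk.support_cons, List.mem_cons, hp.mem_support_iff, hG.reaches_iff hix]
    constructor
    · rintro (rfl | h)
      exacts [⟨Or.inl rfl, hxj.head hix⟩, ⟨Or.inr h.1, h.2⟩]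
    · rintro ⟨rfl | hxv, hvj⟩
      exacts [Or.inl rfl, Or.inr ⟨hxv, hvj⟩]
  uses_iff k l := by
    rw [uses_cons_iff, hp.uses_iff, hG.reaches_iff hix]
    constructor
    · rintro (⟨hkl, ⟨rfl, rfl⟩ | ⟨rfl, rfl⟩⟩ | ⟨hxk, h⟩)
      · exact ⟨Or.inl rfl, hkl, hxj⟩
      · exact absurd (.single hkl) (hG.dag.not_reaches_of_adj hix)
      · exact ⟨Or.inr hxk, h⟩
    · rintro ⟨rfl | hxk, hkl, hlj⟩
      · exact Or.inl ⟨hkl, Or.inl ⟨rfl, hG.rightUnique hkl hix⟩⟩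
      · exact Or.inr ⟨hxk, hkl, hlj⟩

theorem exists_traces (hG : IsDownwardForest G) (hij : ReflTransGen G.Adj i j) :
    ∃ p : (skeleton G).Walk i j, Traces G i j p := by
  induction hij using ReflTransGen.head_induction_on with
  | refl => exact ⟨_, hG.dag.traces_nil j⟩
  | head hix hxj ih =>
    obtain ⟨p, hp⟩ := ih
    exact ⟨_, hG.traces_cons hix hxj hp⟩

theorem exists_trek_of_traces [Finite V] (hG : IsDownwardForest G) (hij : ReflTransGen G.Adj i j)
    {p : (skeleton G).Walk a b} (hp : Traces G i j p) :
    ∃ P : Trek G a b, P.edges = walkEdges G i j ∧ P.top = i := by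
  refine ⟨⟨⟨p, hp.isPath⟩, fun k k' l h h' => ?_⟩, ?_, ?_⟩
  · rw [hp.uses_iff] at h h'
    exact hG.eq_of_reaches_of_adj h.1 h'.1 h.2.1 h'.2.1
  · ext e
    rw [mem_walkEdges]
    simp only [Trek.edges, Set.Finite.mem_toFinset, Set.mem_ofPred_eq, hp.uses_iff]
    exact ⟨fun h => ⟨h.1, h.2.2⟩, fun h => ⟨h.1, e.2, h.2⟩⟩
  · have hex : ∃ v, v ∈ p.support ∧ ∀ u, ¬ Uses G p u v := by
      refine ⟨i, (hp.mem_support_iff i).2 ⟨.refl, hij⟩, fun u hu => ?_⟩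
      rw [hp.uses_iff] at hu
      exact hG.dag.not_reaches_of_adj hu.2.1 hu.1
    obtain ⟨hsupport, hhead⟩ := Classical.epsilon_spec_aux ⟨a⟩ _ hex
    rw [hp.mem_support_iff] at hsupport
    obtain h | ⟨u, hiu, hu⟩ := (ReflTransGen.cases_tail_iff _ _ _).1 hsupport.1
    · exact h
    · exact absurd ((hp.uses_iff _ _).2 ⟨hiu, hu, hsupport.2⟩) (hhead u)

theorem exists_trek [Finite V] (hG : IsDownwardForest G) (hij : ReflTransGen G.Adj i j) :
    ∃ P : Trek G i j, P.edges = walkEdges G i j ∧ P.top = i := by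
  obtain ⟨p, hp⟩ := hG.exists_traces hij
  exact hG.exists_trek_of_traces hij hp

theorem exists_trek_reverse [Finite V] (hG : IsDownwardForest G) (hij : ReflTransGen G.Adj i j) :
    ∃ P : Trek G j i, P.edges = walkEdges G i j ∧ P.top = i := by
  obtain ⟨p, hp⟩ := hG.exists_traces hij
  exact hG.exists_trek_of_traces hij hp.reverse

theorem subsingleton_trek (hG : IsDownwardForest G) (i j : V) : Subsingleton (Trek G i j) :=
  ⟨fun _ _ => Subtype.ext ((hG.isAcyclic_skeleton.subsingleton_path _ _).elim _ _)⟩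

/-- Turning from running along the edges to running against them needs a collider, and turning back
needs two edges leaving the same vertex. -/
theorem reaches_or_exists_uses (hG : IsDownwardForest G) {p : (skeleton G).Walk i j}
    (hp : p.IsPath) (hc : ∀ k k' l, Uses G p k l → Uses G p k' l → k = k') :
    ReflTransGen G.Adj i j ∨ ∃ u, Uses G p u i ∧ ReflTransGen G.Adj j u := by
  induction p with
  | nil => exact Or.inl .refl
  | @cons i x j hix p ih =>
    rw [SimpleGraph.Walk.cons_isPath_iff] at hp
    set q := SimpleGraph.Walk.cons hix p
    have hcons {k l : V} (h : Uses G p k l) : Uses G q k l := uses_cons_iff.2 (Or.inr h)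
    have hrest := ih hp.1 fun k k' l h h' => hc k k' l (hcons h) (hcons h')
    rcases (skeleton_adj.1 hix).2 with hix | hxi
    · have hfirst : Uses G q i x := uses_cons_iff.2 (Or.inl ⟨hix, Or.inl ⟨rfl, rfl⟩⟩)
      rcases hrest with hxj | ⟨u, hux, -⟩
      · exact Or.inl (hxj.head hix)
      · obtain rfl := hc i u x hfirst (hcons hux)
        exact absurd (p.fst_mem_support_of_mem_edges hux.2) hp.2
    · have hfirst : Uses G q x i := uses_cons_iff.2 (Or.inl ⟨hxi, Or.inr ⟨rfl, rfl⟩⟩)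
      rcases hrest with hxj | ⟨u, hux, hju⟩
      · rcases (hG.reaches_iff hxi).1 hxj with rfl | hij
        exacts [Or.inr ⟨_, hfirst, .refl⟩, Or.inl hij]
      · exact Or.inr ⟨x, hfirst, hju.tail hux.1⟩

theorem reaches_or_reaches_of_trek (hG : IsDownwardForest G) (P : Trek G i j) :
    ReflTransGen G.Adj i j ∨ ReflTransGen G.Adj j i :=
  (hG.reaches_or_exists_uses P.1.2 P.2).imp_right fun ⟨_, hui, hju⟩ => hju.tail hui.1

end IsDownwardForest

section TrekSums

variable [Finite V]

/-- The image of `σ_{ab}` under `φ_G`. -/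
def trekSum (G : Digraph V) (a b : V) : MvPolynomial (V ⊕ Edge G) ℂ :=
  ∑ᶠ P : Trek G a b, MvPolynomial.X (Sum.inl P.top) * ∏ e ∈ P.edges, MvPolynomial.X (Sum.inr e)

/-- The exponent vector encoding the pair `(α, y)`: the exponent of `a_v` is `α v` and that of
`λ_{kl}` is `y k`. -/
def flowExponent (G : Digraph V) : (V → ℕ) × (V → ℕ) →+ (V ⊕ Edge G →₀ ℕ) where
  toFun w := Finsupp.equivFunOnFinite.symm (Sum.elim w.1 fun e => w.2 e.1.1)
  map_zero' := by ext (v | e) <;> rfl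
  map_add' w w' := by ext (v | e) <;> rfl

theorem flowExponent_inl (w : (V → ℕ) × (V → ℕ)) (v : V) :
    flowExponent G w (Sum.inl v) = w.1 v := rfl

theorem flowExponent_inr (w : (V → ℕ) × (V → ℕ)) (e : Edge G) :
    flowExponent G w (Sum.inr e) = w.2 e.1.1 := rfl

theorem IsDownwardForest.flowExponent_unitFlow (hG : IsDownwardForest G) (i j : V) :
    flowExponent G (unitFlow G i j) =
      Finsupp.single (Sum.inl i) 1 + ∑ e ∈ walkEdges G i j, Finsupp.single (Sum.inr e) 1 := by
  classical
  ext (v | e)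
  · simp [flowExponent_inl, unitFlow_fst, Pi.single_apply, Finsupp.single_apply, eq_comm]
  · have hmem : ReflTransGen G.Adj i e.1.1 ∧ TransGen G.Adj e.1.1 j ↔ e ∈ walkEdges G i j :=
      (and_congr_right fun _ => hG.transGen_iff e.2).trans mem_walkEdges.symm
    simp [flowExponent_inr, unitFlow, hmem, Finsupp.single_apply]

theorem IsDownwardForest.trekSum_eq_monomial_of_trek (hG : IsDownwardForest G)
    {P : Trek G a b} (hP : P.edges = walkEdges G i j ∧ P.top = i) :
    trekSum G a b = MvPolynomial.monomial (flowExponent G (unitFlow G i j)) 1 := by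
  have := hG.subsingleton_trek a b
  have : Unique (Trek G a b) := uniqueOfSubsingleton P
  rw [trekSum, finsum_unique, Subsingleton.elim default P, hP.1, hP.2, hG.flowExponent_unitFlow,
    ← one_mul (1 : ℂ), ← MvPolynomial.monomial_mul, MvPolynomial.monomial_sum_one]
  rfl

theorem IsDownwardForest.trekSum_eq_monomial (hG : IsDownwardForest G)
    (hij : ReflTransGen G.Adj i j) :
    trekSum G i j = MvPolynomial.monomial (flowExponent G (unitFlow G i j)) 1 :=
  (hG.exists_trek hij).elim fun _ hP => hG.trekSum_eq_monomial_of_trek hP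

theorem IsDownwardForest.trekSum_reverse_eq_monomial (hG : IsDownwardForest G)
    (hij : ReflTransGen G.Adj i j) :
    trekSum G j i = MvPolynomial.monomial (flowExponent G (unitFlow G i j)) 1 :=
  (hG.exists_trek_reverse hij).elim fun _ hP => hG.trekSum_eq_monomial_of_trek hP

theorem IsDownwardForest.span_range_trekSum [LinearOrder V] (hG : IsDownwardForest G) :
    Submodule.span ℂ (Set.range fun p : SigmaIndex V => trekSum G p.1.1 p.1.2) =
      Submodule.span ℂ ((MvPolynomial.monomial · (1 : ℂ)) '' (flowExponent G '' unitFlows G)) := by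
  apply le_antisymm <;> rw [Submodule.span_le]
  · rintro _ ⟨⟨⟨a, b⟩, -⟩, rfl⟩
    rcases isEmpty_or_nonempty (Trek G a b) with h | ⟨⟨P⟩⟩
    · simp only [trekSum, finsum_of_isEmpty]
      exact Submodule.zero_mem _
    · refine Submodule.subset_span ?_
      rcases hG.reaches_or_reaches_of_trek P with hab | hba
      · exact ⟨_, ⟨_, ⟨a, b, hab, rfl⟩, rfl⟩, (hG.trekSum_eq_monomial hab).symm⟩
      · exact ⟨_, ⟨_, ⟨b, a, hba, rfl⟩, rfl⟩, (hG.trekSum_reverse_eq_monomial hba).symm⟩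
  · rintro _ ⟨_, ⟨_, ⟨i, j, hij, rfl⟩, rfl⟩, rfl⟩
    refine Submodule.subset_span ?_
    rcases le_total i j with hle | hle
    · exact ⟨⟨(i, j), hle⟩, hG.trekSum_eq_monomial hij⟩
    · exact ⟨⟨(j, i), hle⟩, hG.trekSum_reverse_eq_monomial hij⟩

end TrekSums

section HilbertSeries

variable [Fintype V]

theorem injOn_flowExponent (G : Digraph V) :
    Set.InjOn (flowExponent G) (flowMonoid G : Set ((V → ℕ) × (V → ℕ))) := by
  intro w hw w' hw' h
  ext v
  · exact DFunLike.congr_fun h (Sum.inl v)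
  · by_cases hv : IsSink G v
    · rw [hw.1 v hv, hw'.1 v hv]
    · obtain ⟨x, hx⟩ := not_forall_not.1 hv
      exact DFunLike.congr_fun h (Sum.inr ⟨(v, x), hx⟩)

theorem IsDownwardForest.hilbertSeries_bayesIdeal [LinearOrder V] (hG : IsDownwardForest G) :
    hilbertSeries (bayesIdeal G) = flowSeries G := by
  let deg : (V ⊕ Edge G →₀ ℕ) →+ ℕ := ∑ v, Finsupp.applyAddHom (Sum.inl v)
  have hdeg (w : (V → ℕ) × (V → ℕ)) : deg (flowExponent G w) = amount w := by
    simp [deg, amount_apply, flowExponent_inl]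
  have hU : ∀ u ∈ flowExponent G '' unitFlows G, deg u = 1 := by
    rintro _ ⟨_, ⟨i, j, -, rfl⟩, rfl⟩
    rw [hdeg, amount_unitFlow]
  refine (hilbertSeries_ker_aeval hG.span_range_trekSum hU).trans ?_
  rw [← AddMonoidHom.map_mclosure, hG.closure_unitFlows, AddSubmonoid.coe_map,
    gradedSeries_image (injOn_flowExponent G)]
  exact congrArg (gradedSeries · _) (funext hdeg)

end HilbertSeries

end Treks

/-! ### Components and degrees -/

section Recursion

variable {G : Digraph V}

/-- The restriction of a directed graph to the vertices satisfying `p`. -/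
def restrict (G : Digraph V) (p : V → Prop) : Digraph {v // p v} where
  Adj u v := G.Adj u.1 v.1

protected theorem IsDownwardForest.restrict (hG : IsDownwardForest G) (p : V → Prop) :
    IsDownwardForest (restrict G p) where
  dag v hv := hG.dag v.1 (TransGen.lift Subtype.val (fun _ _ h => h) _ _ hv)
  rightUnique _ _ _ h h' := Subtype.ext (hG.rightUnique h h')

section DisjointUnions

variable {p q : V → Prop}

theorem isSink_restrict_iff (hp : ∀ u v, G.Adj u v → (p u ↔ p v)) (v : {v // p v}) :
    IsSink (restrict G p) v ↔ IsSink G v.1 :=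
  ⟨fun h w hw => h ⟨w, (hp _ _ hw).1 v.2⟩ hw, fun h w hw => h w.1 hw⟩

/-- The restriction of a pair of functions to the vertices satisfying `p`. -/
def restrictPair (p : V → Prop) (w : (V → ℕ) × (V → ℕ)) :
    ({v // p v} → ℕ) × ({v // p v} → ℕ) :=
  (fun v => w.1 v, fun v => w.2 v)

theorem bijective_restrictPair (hpq : ∀ v, q v ↔ ¬ p v) :
    Function.Bijective fun w : (V → ℕ) × (V → ℕ) => (restrictPair p w, restrictPair q w) := by
  classical
  constructor
  · intro w w' h
    obtain ⟨hp, hq⟩ := Prod.mk.inj h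
    ext v <;> by_cases hv : p v
    · exact congrFun (congrArg Prod.fst hp) ⟨v, hv⟩
    · exact congrFun (congrArg Prod.fst hq) ⟨v, (hpq v).2 hv⟩
    · exact congrFun (congrArg Prod.snd hp) ⟨v, hv⟩
    · exact congrFun (congrArg Prod.snd hq) ⟨v, (hpq v).2 hv⟩
  · rintro ⟨x, y⟩
    refine ⟨(fun v => if h : p v then x.1 ⟨v, h⟩ else y.1 ⟨v, (hpq v).2 h⟩,
      fun v => if h : p v then x.2 ⟨v, h⟩ else y.2 ⟨v, (hpq v).2 h⟩), ?_⟩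
    ext v
    · simp [restrictPair, v.2]
    · simp [restrictPair, v.2]
    · simp [restrictPair, (hpq _).1 v.2]
    · simp [restrictPair, (hpq _).1 v.2]

variable [Fintype V] [Fintype {v // p v}] [Fintype {v // q v}]

theorem inflow_restrict (hp : ∀ u v, G.Adj u v → (p u ↔ p v)) (y : V → ℕ) (v : {v // p v}) :
    inflow (restrict G p) (fun u => y u) v = inflow G y v := by
  classical
  simp only [inflow, Finset.sum_filter]
  rw [← Finset.sum_subset (Finset.subset_univ (Finset.univ.filter p))]
  · exact (Finset.sum_subtype _ (by simp) fun u => if G.Adj u v then y u else 0).symm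
  · exact fun u _ hu => if_neg fun h => hu (by simpa using (hp u v h).2 v.2)

theorem amount_restrictPair_add (hpq : ∀ v, q v ↔ ¬ p v) (w : (V → ℕ) × (V → ℕ)) :
    amount (restrictPair p w) + amount (restrictPair q w) = amount w := by
  classical
  rw [amount_apply w, ← Finset.sum_filter_add_sum_filter_not Finset.univ p w.1,
    Finset.sum_subtype (p := p) (Finset.univ.filter p) (by simp) w.1,
    Finset.sum_subtype (p := q) (Finset.univ.filter fun v => ¬ p v) (by simp [hpq]) w.1]
  rfl

theorem restrictPair_mem_flowMonoid_iff (hp : ∀ u v, G.Adj u v → (p u ↔ p v))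
    {w : (V → ℕ) × (V → ℕ)} : restrictPair p w ∈ flowMonoid (restrict G p) ↔
      ∀ v, p v → (IsSink G v → w.2 v = 0) ∧ w.2 v ≤ w.1 v + inflow G w.2 v := by
  simp only [mem_flowMonoid, isSink_restrict_iff hp, restrictPair, inflow_restrict hp,
    Subtype.forall, forall_and]

theorem mem_flowMonoid_iff_restrictPair (hpq : ∀ v, q v ↔ ¬ p v)
    (hp : ∀ u v, G.Adj u v → (p u ↔ p v)) {w : (V → ℕ) × (V → ℕ)} :
    w ∈ flowMonoid G ↔
      restrictPair p w ∈ flowMonoid (restrict G p) ∧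
        restrictPair q w ∈ flowMonoid (restrict G q) := by
  have hq : ∀ u v, G.Adj u v → (q u ↔ q v) := fun u v h => by rw [hpq, hpq, hp u v h]
  rw [restrictPair_mem_flowMonoid_iff hp, restrictPair_mem_flowMonoid_iff hq, mem_flowMonoid,
    ← forall_and, ← forall_and]
  refine forall_congr' fun v => ?_
  rw [hpq]
  tauto

theorem IsDownwardForest.flowSeries_eq_mul (hG : IsDownwardForest G) (hpq : ∀ v, q v ↔ ¬ p v)
    (hp : ∀ u v, G.Adj u v → (p u ↔ p v)) :
    flowSeries G =
      flowSeries (restrict G p) * flowSeries (restrict G q) := by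
  have hbij := bijective_restrictPair hpq
  have himage : (fun w => (restrictPair p w, restrictPair q w)) ''
      (flowMonoid G : Set ((V → ℕ) × (V → ℕ))) =
      (flowMonoid (restrict G p) : Set _) ×ˢ
        (flowMonoid (restrict G q) : Set _) := by
    rw [← Set.image_preimage_eq (_ ×ˢ _) hbij.surjective]
    exact congrArg _ (Set.ext fun w => mem_flowMonoid_iff_restrictPair hpq hp)
  rw [flowSeries, flowSeries, flowSeries,
    ← gradedSeries_prod (hG.restrict p).finite_flows (hG.restrict q).finite_flows, ← himage,
    gradedSeries_image hbij.injective.injOn]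
  exact congrArg (gradedSeries · _) (funext fun w => (amount_restrictPair_add hpq w).symm)

end DisjointUnions

namespace IsDownwardForest

section Degrees

variable [LinearOrder V]

theorem degree_eq_of_hasPoleAtOne [Fintype V] (hG : IsDownwardForest G) {D : ℕ} {e : ℤ}
    (h : HasPoleAtOne (flowSeries G) D e) (he : e ≠ 0) : degree (bayesIdeal G) = e :=
  HilbertDegree.degree_eq_of_hasPoleAtOne (hG.hilbertSeries_bayesIdeal ▸ h) he

theorem hasPoleAtOne_flowSeries [Fintype V] (hG : IsDownwardForest G) :
    HasPoleAtOne (flowSeries G) (Fintype.card V + Nat.card (Edge G)) (degree (bayesIdeal G)) := by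
  obtain ⟨c, hc, h⟩ := hG.exists_hasPoleAtOne_flowSeries
  rwa [hG.degree_eq_of_hasPoleAtOne h hc.ne']

variable [Finite V]

theorem degree_pos (hG : IsDownwardForest G) : 0 < degree (bayesIdeal G) := by
  have := Fintype.ofFinite V
  obtain ⟨c, hc, h⟩ := hG.exists_hasPoleAtOne_flowSeries
  rwa [hG.degree_eq_of_hasPoleAtOne h hc.ne']

theorem hasDegree (hG : IsDownwardForest G) :
    HasDegree (bayesIdeal G) (degree (bayesIdeal G)) := by
  have := Fintype.ofFinite V
  obtain ⟨Q, hQ, hQe⟩ := hG.hasPoleAtOne_flowSeries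
  exact ⟨_, Q, hG.hilbertSeries_bayesIdeal ▸ hQ, hQe, hG.degree_pos.ne'⟩

theorem degree_eq_sum_walkEdges (hG : IsDownwardForest G) {i t : V} (hi : IsSource G i)
    (ht : IsSink G t) (hit : TransGen G.Adj i t) :
    degree (bayesIdeal G) = ∑ e ∈ walkEdges G i t, degree (bayesIdeal (deleteEdge G e.1)) := by
  have := Fintype.ofFinite V
  have hdelete (e : Edge G) := hG.mono (deleteEdge_le G e.1)
  refine hG.degree_eq_of_hasPoleAtOne (hG.hasPoleAtOne_flowSeries_of_walkEdges hi ht hit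
    (D := Fintype.card V + (Nat.card (Edge G) - 1)) fun e _ => ?_) ?_
  · rw [← card_edge_deleteEdge e, Nat.add_sub_cancel]
    exact (hdelete e).hasPoleAtOne_flowSeries
  · obtain ⟨x, hix, hxt⟩ := TransGen.head'_iff.1 hit
    exact (Finset.sum_pos (fun e _ => (hdelete e).degree_pos)
      ⟨⟨(i, x), hix⟩, mem_walkEdges.2 ⟨.refl, hxt⟩⟩).ne'

theorem degree_eq_one_of_forall_not_adj (hG : IsDownwardForest G) (h : ∀ u v, ¬ G.Adj u v) :
    degree (bayesIdeal G) = 1 := by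
  have := Fintype.ofFinite V
  exact hG.degree_eq_of_hasPoleAtOne (hasPoleAtOne_flowSeries_of_forall_not_adj h) one_ne_zero

theorem degree_eq_mul_component (hG : IsDownwardForest G) {k l : V}
    (hkl : ¬ (skeleton G).Reachable k l)
    (hcover : ∀ w, (skeleton G).Reachable k w ∨ (skeleton G).Reachable l w) :
    degree (bayesIdeal G) =
      degree (bayesIdeal (component G k)) * degree (bayesIdeal (component G l)) := by
  classical
  have := Fintype.ofFinite V
  have hpq (w : V) : (skeleton G).Reachable l w ↔ ¬ (skeleton G).Reachable k w :=
    ⟨fun hlw hkw => hkl (hkw.trans hlw.symm), (hcover w).resolve_left⟩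
  have hp (u v : V) (huv : G.Adj u v) :
      (skeleton G).Reachable k u ↔ (skeleton G).Reachable k v :=
    have huv := reachable_of_reaches (.single huv)
    ⟨fun h => h.trans huv, fun h => h.trans huv.symm⟩
  have hk := hG.restrict fun w => (skeleton G).Reachable k w
  have hl := hG.restrict fun w => (skeleton G).Reachable l w
  have hpole := hk.hasPoleAtOne_flowSeries.mul hl.hasPoleAtOne_flowSeries
  rw [← hG.flowSeries_eq_mul hpq hp] at hpole
  exact hG.degree_eq_of_hasPoleAtOne hpole (mul_pos hk.degree_pos hl.degree_pos).ne'

end Degrees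

theorem reachable_iff_reaches (hG : IsDownwardForest G) {t v w : V} (ht : IsSink G t)
    (hvt : ReflTransGen G.Adj v t) :
    (skeleton G).Reachable v w ↔ ReflTransGen G.Adj w t :=
  ⟨fun h => hG.reaches_of_reachable ht ((reachable_of_reaches hvt).symm.trans h),
    fun h => (reachable_of_reaches hvt).trans (reachable_of_reaches h).symm⟩

theorem isDownwardTree_component (hG : IsDownwardForest G) {t v : V} (ht : IsSink G t)
    (hvt : ReflTransGen G.Adj v t) :
    IsDownwardTree (component G v) ⟨t, reachable_of_reaches hvt⟩ := by
  have hC : IsDownwardForest (component G v) := hG.restrict _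
  have hreaches (w : {w // (skeleton G).Reachable v w}) :
      ReflTransGen (component G v).Adj w ⟨t, reachable_of_reaches hvt⟩ := by
    obtain ⟨w, hvw⟩ := w
    have hwt := (hG.reachable_iff_reaches ht hvt).1 hvw
    induction hwt using ReflTransGen.head_induction_on with
    | refl => exact .refl
    | @head w x hwx hxt ih =>
      exact (ih ((hG.reachable_iff_reaches ht hvt).2 hxt)).head
        (show (component G v).Adj ⟨w, hvw⟩ ⟨x, _⟩ from hwx)
  have : Nonempty {w // (skeleton G).Reachable v w} := ⟨⟨v, .refl v⟩⟩
  exact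
    { isDirTree := ⟨hC.dag, ⟨fun a b => (reachable_of_reaches (hreaches a)).trans
        (reachable_of_reaches (hreaches b)).symm⟩, hC.isAcyclic_skeleton⟩
      isSink_iff := fun w => ⟨fun hw => (hw.eq_of_reaches (hreaches w)).symm,
        by rintro rfl w hw; exact ht _ hw⟩
      toSink := fun _ l _ => hreaches l }

end IsDownwardForest

theorem IsDAG.reaches_deleteEdge_of_adj (hG : IsDAG G) {v w x y : V} (hvx : G.Adj v x)
    (hxy : ReflTransGen G.Adj x y) : ReflTransGen (deleteEdge G (v, w)).Adj x y := by
  induction hxy with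
  | refl => exact .refl
  | @tail a b hxa hab ih =>
    refine ih.tail ⟨hab, fun h => ?_⟩
    obtain ⟨rfl, -⟩ := Prod.mk.inj h
    exact hG.not_reaches_of_adj hvx hxa

namespace IsDownwardTree

variable {T : Digraph V} {s : V}

theorem isSink (hT : IsDownwardTree T s) : IsSink T s := (hT.isSink_iff s).2 rfl

/-- If `v` had two outgoing edges, both would start a directed walk to `s`, so neither would be a
bridge of the skeleton. -/
theorem isDownwardForest (hT : IsDownwardTree T s) : IsDownwardForest T where
  dag := hT.isDirTree.1
  rightUnique v w w' hvw hvw' := by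
    have hdag := hT.isDirTree.1
    by_contra hne
    have hreach {x : V} (hvx : T.Adj v x) : (skeleton (deleteEdge T (v, w))).Reachable x s :=
      reachable_of_reaches (hdag.reaches_deleteEdge_of_adj hvx (hT.toSink v x hvx))
    have hvw'_kept : (deleteEdge T (v, w)).Adj v w' := ⟨hvw', fun h => hne (Prod.mk.inj h).2.symm⟩
    exact hdag.not_reachable_deleteEdge hT.isDirTree.2.isAcyclic hvw
      (((reachable_of_reaches (.single hvw'_kept)).trans (hreach hvw')).trans (hreach hvw).symm)

variable {k l : V}

theorem component_deleteEdge_tail (hT : IsDownwardTree T s) (hkl : T.Adj k l) :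
    IsDownwardTree (component (deleteEdge T (k, l)) k) ⟨k, .refl k⟩ :=
  have hF := hT.isDownwardForest
  (hF.mono (deleteEdge_le T (k, l))).isDownwardTree_component
    ((hF.isSink_deleteEdge_iff hkl).2 (Or.inr rfl)) .refl

variable [Finite V]

theorem reaches (hT : IsDownwardTree T s) (v : V) : ReflTransGen T.Adj v s := by
  obtain ⟨t, ht, hvt⟩ := hT.isDownwardForest.dag.exists_sink v
  rwa [(hT.isSink_iff t).1 ht] at hvt

theorem transGen_of_isLeaf (hT : IsDownwardTree T s) {i : V} (hi : IsLeaf T i) :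
    TransGen T.Adj i s := by
  refine (reflTransGen_iff_eq_or_transGen.1 (hT.reaches i)).resolve_left ?_
  rintro rfl
  obtain ⟨k, hk, -⟩ := hi.2
  exact (skeleton_adj.1 hk).2.elim (hT.isSink k) (hi.1 k)

theorem reaches_tail_or_sink_deleteEdge (hT : IsDownwardTree T s) (hkl : T.Adj k l) (w : V) :
    ReflTransGen (deleteEdge T (k, l)).Adj w k ∨ ReflTransGen (deleteEdge T (k, l)).Adj w s := by
  have hF := hT.isDownwardForest
  obtain ⟨t, ht, hwt⟩ := (hF.mono (deleteEdge_le T (k, l))).dag.exists_sink w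
  rw [hF.isSink_deleteEdge_iff hkl, hT.isSink_iff] at ht
  rcases ht with rfl | rfl
  exacts [Or.inr hwt, Or.inl hwt]

theorem head_reaches_sink_deleteEdge (hT : IsDownwardTree T s) (hkl : T.Adj k l) :
    ReflTransGen (deleteEdge T (k, l)).Adj l s :=
  (hT.reaches_tail_or_sink_deleteEdge hkl l).resolve_left fun hlk =>
    hT.isDownwardForest.dag.not_reaches_of_adj hkl
      (ReflTransGen.mono (deleteEdge_le T (k, l)) _ _ hlk)

theorem component_deleteEdge_head (hT : IsDownwardTree T s) (hkl : T.Adj k l) :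
    IsDownwardTree (component (deleteEdge T (k, l)) l)
      ⟨s, reachable_of_reaches (hT.head_reaches_sink_deleteEdge hkl)⟩ :=
  have hF := hT.isDownwardForest
  (hF.mono (deleteEdge_le T (k, l))).isDownwardTree_component
    ((hF.isSink_deleteEdge_iff hkl).2 (Or.inl hT.isSink))
    (hT.head_reaches_sink_deleteEdge hkl)

theorem degree_deleteEdge [LinearOrder V] (hT : IsDownwardTree T s) (hkl : T.Adj k l) :
    degree (bayesIdeal (deleteEdge T (k, l))) =
      degree (bayesIdeal (component (deleteEdge T (k, l)) k)) *
        degree (bayesIdeal (component (deleteEdge T (k, l)) l)) := by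
  have hF := hT.isDownwardForest
  have hls := reachable_of_reaches (hT.head_reaches_sink_deleteEdge hkl)
  refine (hF.mono (deleteEdge_le T (k, l))).degree_eq_mul_component ?_ fun w => ?_
  · exact hF.dag.not_reachable_deleteEdge hF.isAcyclic_skeleton hkl
  · exact (hT.reaches_tail_or_sink_deleteEdge hkl w).imp
      (fun h => (reachable_of_reaches h).symm)
      (fun h => hls.trans (reachable_of_reaches h).symm)

end IsDownwardTree

end Recursion

end BayesNet

end

theorem mainTheorem10 {V : Type*} [Finite V] [LinearOrder V] (T : Digraph V) (s : V)
    (hT : BayesNet.IsDownwardTree T s) :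
    HilbertDegree.HasDegree (BayesNet.bayesIdeal T)
        (HilbertDegree.degree (BayesNet.bayesIdeal T)) ∧
      (Subsingleton V → HilbertDegree.degree (BayesNet.bayesIdeal T) = 1) ∧
      ∀ i : V, BayesNet.IsLeaf T i →
        ∃ P : BayesNet.Trek T i s, (∀ P' : BayesNet.Trek T i s, P' = P) ∧
          HilbertDegree.degree (BayesNet.bayesIdeal T) =
            ∑ e ∈ P.edges,
              HilbertDegree.degree (BayesNet.bayesIdeal (BayesNet.deleteEdge T e.1)) ∧
          ∀ e ∈ P.edges,
            BayesNet.IsDownwardTree (BayesNet.component (BayesNet.deleteEdge T e.1) e.1.1)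
              ⟨e.1.1, SimpleGraph.Reachable.refl _⟩ ∧
            (∃ hs : (BayesNet.skeleton (BayesNet.deleteEdge T e.1)).Reachable e.1.2 s,
              BayesNet.IsDownwardTree (BayesNet.component (BayesNet.deleteEdge T e.1) e.1.2)
                ⟨s, hs⟩) ∧
            HilbertDegree.degree (BayesNet.bayesIdeal (BayesNet.deleteEdge T e.1)) =
              HilbertDegree.degree (BayesNet.bayesIdeal
                (BayesNet.component (BayesNet.deleteEdge T e.1) e.1.1)) *
              HilbertDegree.degree (BayesNet.bayesIdeal
                (BayesNet.component (BayesNet.deleteEdge T e.1) e.1.2)) := by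
  have hF := hT.isDownwardForest
  refine ⟨hF.hasDegree, fun _ => hF.degree_eq_one_of_forall_not_adj fun u v huv =>
    hF.dag.ne_of_adj huv (Subsingleton.elim u v), fun i hi => ?_⟩
  obtain ⟨P, hP, -⟩ := hF.exists_trek (hT.reaches i)
  refine ⟨P, fun P' => (hF.subsingleton_trek i s).elim P' P, ?_, fun e _ =>
    ⟨hT.component_deleteEdge_tail e.2, ⟨_, hT.component_deleteEdge_head e.2⟩,
      hT.degree_deleteEdge e.2⟩⟩
  rw [hP]
  exact hF.degree_eq_sum_walkEdges hi.1 hT.isSink (hT.transGen_of_isLeaf hi)
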